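/- Work in ZFC. An ultrafilter \(U\) on a set \(X\) is *Fréchet uniform* if \(|A| = |X|\) for every \(A \in U\). An infinite cardinal \(\lambda\) is *Fréchet* if there is a countably complete Fréchet uniform ultrafilter on \(\lambda\). For an ordinal \(\gamma\), \(\gamma^+\) denotes the least cardinal strictly greater than \(\gamma\), and \(\gamma^\sigma\) denotes the least Fréchet cardinal strictly greater than \(\gamma\), if there is one. An uncountable cardinal \(\kappa\) is *\(\omega_1\)-strongly compact* if for every set \(I\), every \(\kappa\)-complete (proper) filter on \(I\) extends to a countably complete ultrafilter on \(I\). Then: 1. If \(\lambda\) is a cardinal and \(\lambda^+\) is Fréchet, then either \(\lambda\) is Fréchet, or \(\lambda\) is singular and all sufficiently large regular cardinals below \(\lambda\) are Fréchet (that is, there is \(\gamma < \lambda\) such that every regular cardinal \(\delta\) with \(\gamma \le \delta < \lambda\) is Fréchet). 2. For every ordinal \(\gamma\) such that \(\gamma^\sigma\) exists, either \(\gamma^\sigma = \gamma^+\) or \(\gamma^\sigma\) is a limit cardinal. 3. If there is an \(\omega_1\)-strongly compact cardinal and \(\kappa\) is the least one, then \(\kappa\) carries a countably complete Fréchet uniform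 ultrafilter. -/

import Mathlib

universe u

namespace FrechetCardinals

open Cardinal

/-- An ultrafilter `U` on `X` is Fréchet uniform if every set in `U` has the cardinality of `X`. -/
def IsFrechetUniform {X : Type u} (U : Ultrafilter X) : Prop :=
  ∀ A ∈ U, #A = #X

/-- An infinite cardinal `lam` is Fréchet if it carries a countably complete Fréchet uniform
ultrafilter. The type `lam.ord.ToType` is the set of ordinals below the initial ordinal of `lam`,
that is, `lam` itself as a von Neumann cardinal. -/
def IsFrechet (lam : Cardinal.{u}) : Prop :=
  ℵ₀ ≤ lam ∧ ∃ U : Ultrafilter lam.ord.ToType,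
    CountableInterFilter (U : Filter lam.ord.ToType) ∧ IsFrechetUniform U

/-- `IsFrechetSucc γ lam` says that `lam` is the least Fréchet cardinal strictly greater than the
ordinal `γ` (the cardinal written `γ^σ`). -/
def IsFrechetSucc (γ : Ordinal.{u}) (lam : Cardinal.{u}) : Prop :=
  IsLeast {μ : Cardinal.{u} | IsFrechet μ ∧ γ < μ.ord} lam

/-- A cardinal is singular if it is infinite and not regular. -/
def IsSingular (lam : Cardinal.{u}) : Prop :=
  ℵ₀ ≤ lam ∧ ¬ lam.IsRegular

/-- An uncountable cardinal `κ` is `ω₁`-strongly compact if every (proper) `κ`-complete filter on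
any set extends to a countably complete ultrafilter on that set. In the order of filters,
`U ≤ F` means that `F ⊆ U` as families of sets. -/
def IsOmegaOneStronglyCompact (κ : Cardinal.{u}) : Prop :=
  ℵ₀ < κ ∧ ∀ (I : Type u) (F : Filter I), F.NeBot → CardinalInterFilter F κ →
    ∃ U : Ultrafilter I, (U : Filter I) ≤ F ∧ CountableInterFilter (U : Filter I)

end FrechetCardinals

namespace FrechetCardinals

open Cardinal Ordinal Order Set Filter

/-! ### Countably complete ultrafilters -/

/-! Everything rests on a Ketonen-minimal countably complete ultrafilter containing all tails of a
Fréchet cardinal θ (`exists_isNormalAlong`): regressive functions are bounded modulo it, and almost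
every point has non-Fréchet cofinality. For regular θ, `IsNormalAlong.exists_cover` then covers θ
modulo the ultrafilter by sets no larger than these cofinalities, and a cover by sets smaller than a
regular δ ≤ θ makes δ Fréchet (`isFrechet_of_cover`).

For claim 1, if functions into λ are bounded modulo the ultrafilter on λ⁺, a pigeonhole argument
makes all large regular δ ≤ λ Fréchet. This settles λ regular and not Fréchet, and λ singular with
non-Fréchet cofinality. If cf λ is Fréchet, either λ is a limit of Fréchet cardinals, hence Fréchet,
or a gap below λ is refuted by `not_isFrechet_succ`. Claim 2 follows from claim 1 and minimality.

For claim 3, all regular cardinals from κ on are Fréchet. If κ is singular and not Fréchet, claim 1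
at κ⁺ pushes this below κ, and the covers yield a smaller ω₁-strongly compact cardinal. -/

theorem countableInterFilter_bind {X Y : Type*} {U : Ultrafilter X} {V : X → Ultrafilter Y}
    (hU : CountableInterFilter (U : Filter X))
    (hV : ∀ᶠ x in (U : Filter X), CountableInterFilter (V x : Filter Y)) :
    CountableInterFilter (U.bind V : Filter Y) := by
  refine ⟨fun S hS hSU => ?_⟩
  have h : ∀ᶠ x in (U : Filter X), ∀ s ∈ S, s ∈ V x :=
    (eventually_countable_ball hS).2 fun s hs => hSU s hs
  change ∀ᶠ x in (U : Filter X), ⋂₀ S ∈ V x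
  filter_upwards [h, hV] with x hx hVx
  exact (countable_sInter_mem hS).2 hx

theorem countableInterFilter_map {X Y : Type*} {U : Ultrafilter X}
    (hU : CountableInterFilter (U : Filter X)) (f : X → Y) :
    CountableInterFilter (U.map f : Filter Y) := by
  rw [Ultrafilter.coe_map]; infer_instance

theorem countableInterFilter_pure {X : Type*} (x : X) :
    CountableInterFilter ((pure x : Ultrafilter X) : Filter X) :=
  ⟨fun _ _ h => fun s hs => h s hs⟩

theorem isFrechet_mk {Y : Type u} (hY : ℵ₀ ≤ #Y) (U : Ultrafilter Y)
    (hU : CountableInterFilter (U : Filter Y)) (hunif : IsFrechetUniform U) : IsFrechet #Y := by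
  obtain ⟨e⟩ : Nonempty (Y ≃ (#Y).ord.ToType) := Cardinal.eq.1 (by simp)
  refine ⟨hY, U.map e, countableInterFilter_map hU e, fun A hA => ?_⟩
  have h := hunif _ (Ultrafilter.mem_map.1 hA)
  rw [mk_preimage_equiv] at h
  simpa using h

/-- Every countably complete ultrafilter concentrates on a set whose cardinality is finite or
Fréchet. -/
theorem exists_mem_finite_or_isFrechet {Y : Type u} (U : Ultrafilter Y)
    (hU : CountableInterFilter (U : Filter Y)) : ∃ B ∈ U, #B < ℵ₀ ∨ IsFrechet #B := by
  obtain ⟨B, hB, hmin⟩ := exists_minimalFor_of_wellFoundedLT (fun B : Set Y => B ∈ U)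
    (fun B => #B) ⟨univ, Filter.univ_mem⟩
  refine ⟨B, hB, or_iff_not_imp_left.2 fun hinf => ?_⟩
  have hr : range (Subtype.val : B → Y) ∈ U := by simpa using hB
  refine isFrechet_mk (not_lt.1 hinf) (U.comap Subtype.val_injective hr) ?_ fun A hA => ?_
  · rw [Ultrafilter.coe_comap]; infer_instance
  · rw [Ultrafilter.mem_comap] at hA
    refine le_antisymm (mk_set_le A) ?_
    have h := hmin hA
    rw [← mk_image_eq (f := (Subtype.val : B → Y)) (s := A) Subtype.val_injective]
    by_contra! hlt
    exact hlt.not_ge (h hlt.le)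

/-- The pushforward concentrates on a set of finite or Fréchet size, and the gap rules out sizes in
(γ, λ]. -/
theorem exists_set_card_le {X Y : Type u} {U : Ultrafilter X}
    (hU : CountableInterFilter (U : Filter X)) {γ lam : Cardinal.{u}} (hγ : ℵ₀ ≤ γ)
    (hgap : ∀ μ, γ < μ → μ ≤ lam → ¬ IsFrechet μ) (hY : #Y ≤ lam) (f : X → Y) :
    ∃ B : Set Y, #B ≤ γ ∧ ∀ᶠ x in (U : Filter X), f x ∈ B := by
  obtain ⟨B, hB, h⟩ := exists_mem_finite_or_isFrechet (U.map f) (countableInterFilter_map hU f)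
  refine ⟨B, ?_, hB⟩
  rcases h with h | h
  · exact h.le.trans hγ
  · by_contra! hlt
    exact hgap _ hlt ((mk_set_le B).trans hY) h

/-- A point of `o.ToType` with prescribed position. -/
theorem exists_toType {o : Ordinal.{u}} {b : Ordinal.{u}} (h : b < o) :
    ∃ i : o.ToType, (i : Ordinal) = b :=
  ⟨ToType.mk ⟨b, h⟩, by simp⟩

theorem toType_lt {o : Ordinal.{u}} (i : o.ToType) : (i : Ordinal) < o := i.toOrd.2

theorem toType_lt_iff {o : Ordinal.{u}} {i j : o.ToType} : (i : Ordinal) < j ↔ i < j := by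
  simp

theorem toType_le_iff {o : Ordinal.{u}} {i j : o.ToType} : (i : Ordinal) ≤ j ↔ i ≤ j := by
  simp

theorem iSup_lt_ord {ι : Type u} {ρ : Cardinal.{u}} (hρ : ρ.IsRegular) (hι : #ι < ρ)
    {f : ι → Ordinal.{u}} (hf : ∀ i, f i < ρ.ord) : ⨆ i, f i < ρ.ord :=
  iSup_lt_of_lt_cof (by rwa [hρ.cof_ord]) hf

/-- A function into a regular cardinal that is unbounded modulo a countably complete ultrafilter
witnesses that the cardinal is Fréchet. -/
theorem isFrechet_of_unbounded {X : Type u} {U : Ultrafilter X}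
    (hU : CountableInterFilter (U : Filter X)) {δ : Cardinal.{u}} (hδ : δ.IsRegular)
    (f : X → Ordinal.{u}) (hf : ∀ᶠ x in (U : Filter X), f x < δ.ord)
    (hunb : ∀ η < δ.ord, ∀ᶠ x in (U : Filter X), η ≤ f x) : IsFrechet δ := by
  classical
  obtain ⟨z, -⟩ := exists_toType hδ.ord_pos
  let g : X → δ.ord.ToType := fun x => if h : f x < δ.ord then ToType.mk ⟨f x, h⟩ else z
  have hg : ∀ x, f x < δ.ord → (g x : Ordinal) = f x := fun x h => by simp [g, h]
  refine ⟨hδ.aleph0_le, U.map g, countableInterFilter_map hU g, fun A hA => ?_⟩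
  refine le_antisymm (mk_set_le A) ?_
  rw [mk_ord_toType]
  conv_lhs => rw [← hδ.cof_ord, ← cof_toType]
  -- Every set in the image ultrafilter is cofinal in δ.
  refine Order.cof_le fun i => ?_
  have hA' : ∀ᶠ x in (U : Filter X), g x ∈ A := hA
  obtain ⟨x, hx, hxf, hxi⟩ := (hA'.and (hf.and (hunb i (toType_lt i)))).exists
  exact ⟨g x, hx, toType_le_iff.1 (by rwa [hg x hxf])⟩

theorem exists_bound_of_not_isFrechet {X : Type u} {U : Ultrafilter X}
    (hU : CountableInterFilter (U : Filter X)) {δ : Cardinal.{u}} (hδ : δ.IsRegular)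
    (hδF : ¬ IsFrechet δ) (f : X → Ordinal.{u}) (hf : ∀ᶠ x in (U : Filter X), f x < δ.ord) :
    ∃ η < δ.ord, ∀ᶠ x in (U : Filter X), f x < η := by
  by_contra! h
  refine hδF (isFrechet_of_unbounded hU hδ f hf fun η hη => ?_)
  have := h η hη
  rw [← Ultrafilter.frequently_iff_eventually]
  simpa using this

/-- In the absence of Fréchet cardinals in `(γ, lam]`, a function that is everywhere below a
regular-valued function `r` is bounded by a function that only depends on `r`. -/
theorem exists_uniform_bound {X : Type u} {U : Ultrafilter X}
    (hU : CountableInterFilter (U : Filter X)) {γ lam : Cardinal.{u}} (hγ : ℵ₀ ≤ γ)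
    (hlam : 0 < lam) (hgap : ∀ μ, γ < μ → μ ≤ lam → ¬ IsFrechet μ) (r : X → Cardinal.{u})
    (hr : ∀ᶠ x in (U : Filter X), r x ≤ lam) (e : X → Ordinal.{u})
    (he : ∀ᶠ x in (U : Filter X), e x < (r x).ord) :
    ∃ η : Cardinal.{u} → Ordinal.{u}, (∀ ρ : Cardinal.{u}, ρ.IsRegular → γ < ρ → η ρ < ρ.ord) ∧
      ∀ᶠ x in (U : Filter X), e x ≤ η (r x) := by
  classical
  obtain ⟨z, -⟩ := exists_toType (ord_pos.2 hlam)
  let g : X → lam.ord.ToType := fun x => if h : e x < lam.ord then ToType.mk ⟨e x, h⟩ else z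
  have hg : ∀ x, e x < lam.ord → (g x : Ordinal) = e x := fun x h => by simp [g, h]
  obtain ⟨B, hB, hgB⟩ := exists_set_card_le hU hγ hgap (mk_ord_toType lam).le g
  -- Modulo `U`, `e` takes at most γ values; the supremum of those below ρ stays below ρ by
  -- regularity.
  refine ⟨fun ρ => ⨆ b : B, if (b.1 : Ordinal) < ρ.ord then (b.1 : Ordinal) else 0,
    fun ρ hρ hγρ => iSup_lt_ord hρ (hB.trans_lt hγρ) fun b => ?_, ?_⟩
  · split_ifs with h
    exacts [h, hρ.ord_pos]
  · filter_upwards [hgB, hr, he] with x hx hrx hex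
    have h1 := hg x (hex.trans_le (ord_le_ord.2 hrx))
    refine le_trans ?_ (Ordinal.le_iSup _ ⟨g x, hx⟩)
    simp [h1, hex]

/-! ### The Ketonen order and normal ultrafilters -/

/-- `U'` is below `U` in the Ketonen order: it is an integral along `U` of countably complete
ultrafilters, almost all of them concentrating on points below their index. -/
def KetonenLT {X : Type u} [LT X] (U' U : Ultrafilter X) : Prop :=
  ∃ V : X → Ultrafilter X,
    (∀ᶠ x in (U : Filter X), CountableInterFilter (V x : Filter X) ∧ {y | y < x} ∈ V x) ∧
      U' = U.bind V

/-- The Ketonen order on countably complete ultrafilters is well-founded. -/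
theorem exists_ketonenLT_minimal {X : Type u} [LT X] [WellFoundedLT X] (P : Ultrafilter X → Prop)
    (hP : ∀ U, P U → CountableInterFilter (U : Filter X)) (hne : ∃ U, P U) :
    ∃ U, P U ∧ ∀ U', P U' → ¬ KetonenLT U' U := by
  by_contra! h
  choose next hnext hlt using h
  obtain ⟨U₀, hU₀⟩ := hne
  let s : ℕ → {U // P U} := Nat.rec ⟨U₀, hU₀⟩ fun _ U => ⟨next U.1 U.2, hnext U.1 U.2⟩
  have hs : ∀ n, KetonenLT (s (n + 1)).1 (s n).1 := fun n => hlt _ _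
  choose V hV hbind using hs
  -- `R k n` holds the points from which `k + 1` successive descents, starting with `V n`, behave as
  -- required; a point in all of them would start an infinite descent.
  let R : ℕ → ℕ → Set X := Nat.rec
    (fun n => {x | CountableInterFilter (V n x : Filter X) ∧ {y | y < x} ∈ V n x})
    fun _ Rk n => Rk n ∩ {x | Rk (n + 1) ∈ V n x}
  have hR : ∀ k n, R k n ∈ (s n).1 := by
    intro k
    induction k with
    | zero => exact hV
    | succ k ih =>
      intro n
      refine Filter.inter_mem (ih n) ?_
      have h := ih (n + 1)
      rw [hbind n] at h
      exact h
  have hempty : ∀ x n, x ∉ ⋂ k, R k n := by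
    intro x
    induction x using WellFoundedLT.induction with
    | ind x ih =>
      intro n hx
      rw [mem_iInter] at hx
      obtain ⟨hc, hlt⟩ := hx 0
      have h1 : (⋂ k, R k (n + 1)) ∈ V n x :=
        countable_iInter_mem.2 fun k => (hx (k + 1)).2
      obtain ⟨y, hy, hyx⟩ := Ultrafilter.nonempty_of_mem (Filter.inter_mem h1 hlt)
      exact ih y hyx (n + 1) hy
  have h0 := hP _ (s 0).2
  obtain ⟨x, hx⟩ := Ultrafilter.nonempty_of_mem
    (show (⋂ k, R k 0) ∈ (s 0).1 from countable_iInter_mem.2 fun k => hR k 0)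
  exact hempty x 0 hx

theorem Ioi_mem_of_isFrechetUniform {c : Cardinal.{u}} (hc : ℵ₀ ≤ c)
    {W : Ultrafilter c.ord.ToType} (hW : IsFrechetUniform W) (i : c.ord.ToType) : Ioi i ∈ W := by
  by_contra h
  rw [← Ultrafilter.compl_mem_iff_notMem, compl_Ioi] at h
  have h1 := hW _ h
  have h2 : #(Iic i) < c := by
    rw [← Iio_insert]
    refine mk_insert_le.trans_lt (add_lt_of_lt hc ?_ (one_lt_aleph0.trans_le hc))
    simpa using mk_Iio_lt i (by simp)
  rw [h1, mk_ord_toType] at h2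
  exact h2.false

theorem exists_ultrafilter_Iio {o : Ordinal.{u}} (x : o.ToType)
    (hx : IsFrechet (x : Ordinal.{u}).cof) :
    ∃ V : Ultrafilter o.ToType, CountableInterFilter (V : Filter o.ToType) ∧ {y | y < x} ∈ V ∧
      ∀ z < x, Ioi z ∈ V := by
  obtain ⟨hc, W, hWc, hW⟩ := hx
  obtain ⟨f, hf⟩ := exists_isFundamentalSeq (o := (x : Ordinal.{u})) rfl
  let g : (x : Ordinal.{u}).cof.ord.ToType → o.ToType := fun i =>
    ToType.mk ⟨f i.toOrd, (f i.toOrd).2.trans (toType_lt x)⟩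
  have hg : ∀ i, (g i : Ordinal) = f i.toOrd := fun i => by simp [g]
  refine ⟨W.map g, countableInterFilter_map hWc g, ?_, fun z hz => ?_⟩
  · refine Ultrafilter.mem_map.2 (Filter.mem_of_superset Filter.univ_mem fun i _ => ?_)
    change g i < x
    rw [← toType_lt_iff, hg]
    exact (f i.toOrd).2
  · obtain ⟨_, ⟨j, rfl⟩, hj⟩ := hf.isCofinal_range ⟨z, toType_lt_iff.2 hz⟩
    refine Ultrafilter.mem_map.2 (Filter.mem_of_superset
      (Ioi_mem_of_isFrechetUniform hc hW (ToType.mk j)) fun i hi => ?_)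
    change z < g i
    rw [← toType_lt_iff, hg]
    have hji : j < i.toOrd := by
      have : ToType.mk j < i := hi
      rwa [← OrderIso.lt_symm_apply] at this
    exact lt_of_le_of_lt (show (z : Ordinal) ≤ (f j : Ordinal) from hj) (hf.strictMono hji)

/-- `a` represents an ordinal of the ultrapower by `U` that lies below the image of `θ` and above
all images of ordinals below `θ`. -/
structure IsCofinalAlong (θ : Cardinal.{u}) {X : Type u} (U : Ultrafilter X)
    (a : X → Ordinal.{u}) : Prop where
  countable : CountableInterFilter (U : Filter X)
  lt : ∀ x, a x < θ.ord
  tail : ∀ ξ < θ.ord, ∀ᶠ x in (U : Filter X), ξ < a x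

/-- `a` represents the supremum of the images of the ordinals below `θ`, and its cofinality is
almost nowhere Fréchet. -/
structure IsNormalAlong (θ : Cardinal.{u}) {X : Type u} (U : Ultrafilter X)
    (a : X → Ordinal.{u}) : Prop extends IsCofinalAlong θ U a where
  regressive : ∀ f : X → Ordinal.{u}, (∀ᶠ x in (U : Filter X), f x < a x) →
    ∃ ξ < θ.ord, ∀ᶠ x in (U : Filter X), f x ≤ ξ
  not_isFrechet_cof : ∀ᶠ x in (U : Filter X), ¬ IsFrechet (a x).cof

/-- An unbounded regressive function, or Fréchet cofinalities almost everywhere, would each produce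
a Ketonen-smaller ultrafilter containing all tails: a pushforward, or an integral of ultrafilters
containing the tails of each point. -/
theorem exists_isNormalAlong {θ : Cardinal.{u}} (hθ : IsFrechet θ) :
    ∃ (X : Type u) (U : Ultrafilter X) (a : X → Ordinal.{u}), IsNormalAlong θ U a := by
  classical
  obtain ⟨hc, W, hWc, hW⟩ := hθ
  obtain ⟨U, ⟨hU, htail⟩, hmin⟩ := exists_ketonenLT_minimal
    (fun U : Ultrafilter θ.ord.ToType =>
      CountableInterFilter (U : Filter θ.ord.ToType) ∧ ∀ i, Ioi i ∈ U)
    (fun U hU => hU.1) ⟨W, hWc, Ioi_mem_of_isFrechetUniform hc hW⟩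
  refine ⟨θ.ord.ToType, U, fun x => x, ⟨hU, toType_lt, fun ξ hξ => ?_⟩, fun f hf => ?_, ?_⟩
  · obtain ⟨i, rfl⟩ := exists_toType hξ
    filter_upwards [htail i] with x hx using toType_lt_iff.2 hx
  · by_contra! hunb
    let g : θ.ord.ToType → θ.ord.ToType := fun x =>
      if h : f x < θ.ord then ToType.mk ⟨f x, h⟩ else x
    have hg : ∀ x, f x < (x : Ordinal) → (g x : Ordinal) = f x := fun x h => by
      simp [g, h.trans (toType_lt x)]
    refine hmin (U.bind fun x => pure (g x)) ⟨countableInterFilter_bind hU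
      (Eventually.of_forall fun x => countableInterFilter_pure _), fun i => ?_⟩
      ⟨_, ?_, rfl⟩
    · have h1 := hunb i (toType_lt i)
      change ∀ᶠ x in (U : Filter θ.ord.ToType), g x ∈ Ioi i
      filter_upwards [h1, hf] with x hx hxf
      rw [mem_Ioi, ← toType_lt_iff, hg x hxf]
      exact hx
    · filter_upwards [hf] with x hx
      refine ⟨countableInterFilter_pure _, ?_⟩
      change g x < x
      rw [← toType_lt_iff, hg x hx]
      exact hx
  · by_contra h
    have h1 : ∀ᶠ x : θ.ord.ToType in U, IsFrechet (x : Ordinal.{u}).cof := by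
      simpa using (Ultrafilter.eventually_not.not.1 h)
    let V : θ.ord.ToType → Ultrafilter θ.ord.ToType := fun x =>
      if h : IsFrechet (x : Ordinal.{u}).cof then (exists_ultrafilter_Iio x h).choose else pure x
    have hV : ∀ x : θ.ord.ToType, IsFrechet (x : Ordinal.{u}).cof →
        CountableInterFilter (V x : Filter θ.ord.ToType) ∧ {y | y < x} ∈ V x ∧
          ∀ z < x, Ioi z ∈ V x := fun x hx => by
      simp only [V, dif_pos hx]
      exact (exists_ultrafilter_Iio x hx).choose_spec
    refine hmin (U.bind V) ⟨countableInterFilter_bind hU ?_, fun i => ?_⟩ ⟨V, ?_, rfl⟩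
    · filter_upwards [h1] with x hx using (hV x hx).1
    · change ∀ᶠ x in (U : Filter θ.ord.ToType), Ioi i ∈ V x
      filter_upwards [h1, htail i] with x hx hxi using (hV x hx).2.2 i hxi
    · filter_upwards [h1] with x hx using ⟨(hV x hx).1, (hV x hx).2.1⟩

/-! ### Boundedness, sums and covering -/

theorem exists_cofinal_seq (o : Ordinal.{u}) : ∃ cs pos : Ordinal.{u} → Ordinal.{u},
    (∀ i < o.cof.ord, cs i < o) ∧ (∀ i j, i < j → j < o.cof.ord → cs i < cs j) ∧
      ∀ ξ < o, pos ξ < o.cof.ord ∧ ξ ≤ cs (pos ξ) := by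
  classical
  obtain ⟨f, hf⟩ := exists_isFundamentalSeq (o := o) rfl
  have h : ∀ ξ, ∃ i, ∀ h : ξ < o, ∃ hi : i < o.cof.ord, ξ ≤ f ⟨i, hi⟩ := fun ξ => by
    by_cases h : ξ < o
    · obtain ⟨_, ⟨j, rfl⟩, hj⟩ := hf.isCofinal_range ⟨ξ, h⟩
      exact ⟨j, fun _ => ⟨j.2, hj⟩⟩
    · exact ⟨0, fun h' => absurd h' h⟩
  choose pos hpos using h
  refine ⟨fun i => if h : i < o.cof.ord then f ⟨i, h⟩ else 0, pos, fun i hi => ?_,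
    fun i j hij hj => ?_, fun ξ hξ => ?_⟩
  · simp only [dif_pos hi]
    exact (f ⟨i, hi⟩).2
  · simp only [dif_pos hj, dif_pos (hij.trans hj)]
    exact hf.strictMono (show (⟨i, hij.trans hj⟩ : Iio o.cof.ord) < ⟨j, hj⟩ from hij)
  · obtain ⟨hi, hle⟩ := hpos ξ hξ
    exact ⟨hi, by simpa only [dif_pos hi] using hle⟩

theorem toType_coe_injective {o : Ordinal.{u}} :
    Function.Injective fun i : o.ToType => (i : Ordinal) :=
  fun _ _ h => ToType.mk.symm.injective (Subtype.ext h)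

theorem exists_injOn_Iio {α : Ordinal.{u}} {lam : Cardinal.{u}} (h : α.card ≤ lam) :
    ∃ F : Ordinal.{u} → Ordinal.{u}, InjOn F (Iio α) ∧ ∀ ξ < α, F ξ < lam.ord := by
  classical
  obtain ⟨e⟩ : Nonempty (α.ToType ↪ lam.ord.ToType) := by
    rw [← Cardinal.le_def]; simpa using h
  refine ⟨fun ξ => if h : ξ < α then e (ToType.mk ⟨ξ, h⟩) else 0, fun ξ hξ ζ hζ hF => ?_,
    fun ξ hξ => ?_⟩
  · simp only [dif_pos (mem_Iio.1 hξ), dif_pos (mem_Iio.1 hζ)] at hF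
    exact congrArg Subtype.val (ToType.mk.injective (e.injective (toType_coe_injective hF)))
  · simp only [dif_pos hξ]
    exact toType_lt _

theorem exists_bound_of_not_isFrechet_cof {X : Type u} {U : Ultrafilter X}
    (hU : CountableInterFilter (U : Filter X)) {lam : Cardinal.{u}} (hlam : ℵ₀ ≤ lam)
    (hF : ¬ IsFrechet lam.ord.cof) (f : X → Ordinal.{u})
    (hf : ∀ᶠ x in (U : Filter X), f x < lam.ord) :
    ∃ η < lam.ord, ∀ᶠ x in (U : Filter X), f x < η := by
  obtain ⟨cs, pos, hcs, hmono, hpos⟩ := exists_cofinal_seq lam.ord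
  obtain ⟨η, hη, h⟩ := exists_bound_of_not_isFrechet hU (isRegular_cof (isSuccLimit_ord hlam)) hF
    (fun x => pos (f x)) (hf.mono fun x hx => (hpos _ hx).1)
  refine ⟨cs η, hcs η hη, ?_⟩
  filter_upwards [hf, h] with x hx hxη
  exact (hpos _ hx).2.trans_lt (hmono _ _ hxη hη)

/-- A small covering modulo `U` of a set of regular size `δ` witnesses that `δ` is Fréchet. -/
theorem isFrechet_of_cover {X : Type u} {U : Ultrafilter X}
    (hU : CountableInterFilter (U : Filter X)) {δ : Cardinal.{u}} (hδ : δ.IsRegular) {Y : Type u}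
    (hY : δ ≤ #Y) (D : X → Set Y) (hD : ∀ i, ∀ᶠ x in (U : Filter X), i ∈ D x)
    (hcard : ∀ᶠ x in (U : Filter X), #(D x) < δ) : IsFrechet δ := by
  obtain ⟨s⟩ : Nonempty (δ.ord.ToType ↪ Y) := by
    rwa [← Cardinal.le_def, mk_ord_toType]
  refine isFrechet_of_unbounded hU hδ (fun x => ⨆ i : s ⁻¹' D x, (i.1 : Ordinal)) ?_ fun η hη => ?_
  · filter_upwards [hcard] with x hx
    exact iSup_lt_ord hδ ((mk_preimage_of_injective _ _ s.injective).trans_lt hx)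
      fun i => toType_lt i.1
  · obtain ⟨i, rfl⟩ := exists_toType hη
    filter_upwards [hD (s i)] with x hx
    exact Ordinal.le_iSup (fun i : s ⁻¹' D x => (i.1 : Ordinal)) ⟨i, hx⟩

/-- If every function into `lam` is bounded modulo a countably complete ultrafilter that is uniform
on `lam⁺`, then all sufficiently large regular cardinals up to `lam` are Fréchet. -/
theorem exists_forall_isRegular_isFrechet {lam : Cardinal.{u}} (hlam : ℵ₀ ≤ lam) {X : Type u}
    {U : Ultrafilter X} {a : X → Ordinal.{u}} (h : IsCofinalAlong (succ lam) U a)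
    (hb : ∀ f : X → Ordinal.{u}, (∀ᶠ x in (U : Filter X), f x < lam.ord) →
      ∃ η < lam.ord, ∀ᶠ x in (U : Filter X), f x < η) :
    ∃ γ < lam, ∀ δ : Cardinal.{u}, δ.IsRegular → γ < δ → δ ≤ lam → IsFrechet δ := by
  have hcard : ∀ x, (a x).card ≤ lam := fun x => lt_succ_iff.1 (lt_ord.1 (h.lt x))
  choose F hFinj hFlt using fun x => exists_injOn_Iio (hcard x)
  have hg : ∀ ξ : (succ lam).ord.ToType, ∃ b : lam.ord.ToType,
      ∀ᶠ x in (U : Filter X), (ξ : Ordinal) < a x ∧ F x ξ < b := fun ξ => by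
    have h1 := h.tail ξ (toType_lt ξ)
    obtain ⟨η, hη, h2⟩ := hb (fun x => F x ξ) (h1.mono fun x hx => hFlt x _ hx)
    obtain ⟨b, rfl⟩ := exists_toType hη
    exact ⟨b, h1.and h2⟩
  choose g hg using hg
  have hreg := isRegular_succ hlam
  -- λ⁺ many ξ share one bound `b`; injectivity of `F x` leaves at most |b| of them in each covering
  -- set.
  obtain ⟨b, hb⟩ := infinite_pigeonhole_card g (succ lam) (by simp) hreg.aleph0_le
    (by rw [hreg.cof_ord]; simp)
  refine ⟨(b : Ordinal).card, lt_ord.1 (toType_lt b), fun δ hδ hbδ hδlam => ?_⟩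
  refine isFrechet_of_cover h.countable hδ ((hδlam.trans (le_succ lam)).trans hb)
    (fun x => {i : g ⁻¹' {b} | (i.1 : Ordinal) < a x ∧ F x i.1 < b}) (fun i => ?_)
    (Eventually.of_forall fun x => lt_of_le_of_lt ?_ hbδ)
  · have h1 := hg i.1
    rwa [show g i.1 = b from i.2] at h1
  · rw [← mk_toType]
    refine mk_le_of_injective
      (f := fun i : {i : g ⁻¹' {b} | (i.1 : Ordinal) < a x ∧ F x i.1 < b} =>
        (ToType.mk ⟨F x i.1.1, i.2.2⟩ : (b : Ordinal.{u}).ToType)) fun i j hij => ?_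
    have h1 : F x i.1.1 = F x j.1.1 := congrArg Subtype.val (ToType.mk.injective hij)
    exact Subtype.ext (Subtype.ext (toType_coe_injective (hFinj x i.2.1 j.2.1 h1)))

/-- A limit of Fréchet cardinals whose cofinality is Fréchet is Fréchet. -/
theorem isFrechet_of_isFrechet_cof {lam : Cardinal.{u}} (hlam : ℵ₀ ≤ lam)
    (hcof : IsFrechet lam.ord.cof) (hlim : ∀ γ < lam, ∃ μ, γ < μ ∧ μ < lam ∧ IsFrechet μ) :
    IsFrechet lam := by
  obtain ⟨hc, W, hWc, hW⟩ := hcof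
  obtain ⟨cs, pos, hcs, hmono, hpos⟩ := exists_cofinal_seq lam.ord
  have h1 : ∀ i : lam.ord.cof.ord.ToType, ∃ V : Ultrafilter lam.ord.ToType,
      CountableInterFilter (V : Filter lam.ord.ToType) ∧
        ∀ A ∈ V, (cs i).card < #A := fun i => by
    obtain ⟨μ, hμ, hμlam, -, V, hVc, hV⟩ := hlim _ (lt_ord.1 (hcs i (toType_lt i)))
    obtain ⟨e⟩ : Nonempty (μ.ord.ToType ↪ lam.ord.ToType) := by
      rw [← Cardinal.le_def]; simpa using hμlam.le
    refine ⟨V.map e, countableInterFilter_map hVc e, fun A hA => hμ.trans_le ?_⟩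
    rw [← mk_ord_toType μ, ← hV _ (Ultrafilter.mem_map.1 hA)]
    exact mk_preimage_of_injective _ _ e.injective
  choose V hVc hV using h1
  have h := isFrechet_mk (by simpa using hlam) (W.bind V)
    (countableInterFilter_bind hWc (Eventually.of_forall hVc)) fun A hA => by
      refine le_antisymm (mk_set_le A) ?_
      by_contra! hlt
      rw [mk_ord_toType] at hlt
      obtain ⟨hj, hle⟩ := hpos _ (ord_lt_ord.2 hlt)
      obtain ⟨j, hj'⟩ := exists_toType hj
      have hA' : ∀ᶠ i in (W : Filter lam.ord.cof.ord.ToType), A ∈ V i := hA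
      obtain ⟨i, hi, hij⟩ := (hA'.and (Ioi_mem_of_isFrechetUniform hc hW j)).exists
      have h2 := hmono j i (toType_lt_iff.2 hij) (toType_lt i)
      rw [hj'] at h2
      refine (hV i A hi).not_ge ?_
      rw [← ord_le]
      exact hle.trans h2.le
  rwa [mk_ord_toType] at h

/-- The images of the ordinals below `θ` are covered by a set whose size in the ultrapower is the
cofinality of their supremum. -/
theorem IsNormalAlong.exists_cover {θ : Cardinal.{u}} (hθ : θ.IsRegular) {X : Type u}
    {U : Ultrafilter X} {a : X → Ordinal.{u}} (h : IsNormalAlong θ U a) :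
    ∃ D : X → Set θ.ord.ToType, (∀ x, #(D x) ≤ (a x).cof) ∧
      ∀ i, ∀ᶠ x in (U : Filter X), i ∈ D x := by
  choose cs pos hcs hmono hpos using fun x => exists_cofinal_seq (a x)
  have ht : ∀ ξ, ∃ t, ξ < θ.ord → t < θ.ord ∧ ∀ᶠ x in (U : Filter X), cs x (pos x ξ) ≤ t :=
    fun ξ => by
      by_cases hξ : ξ < θ.ord
      · obtain ⟨t, ht⟩ := h.regressive (fun x => cs x (pos x ξ))
          ((h.tail ξ hξ).mono fun x hx => hcs x _ (hpos x _ hx).1)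
        exact ⟨t, fun _ => ht⟩
      · exact ⟨0, fun h => absurd h hξ⟩
  choose t ht using ht
  -- Thin out θ so that `s i` exceeds every earlier `t (s j)`: distinct covered points then have
  -- distinct positions in the cofinal sequence of `a x`.
  obtain ⟨s, hs⟩ : ∃ s : θ.ord.ToType → Ordinal.{u}, ∀ i, s i = ⨆ j : Iio i, (t (s j) + 1) :=
    ⟨WellFounded.fix (wellFounded_lt (α := θ.ord.ToType))
      fun i ih => ⨆ j : Iio i, (t (ih j j.2) + 1), fun i => WellFounded.fix_eq _ _ i⟩
  have hslt : ∀ i, s i < θ.ord := fun i => by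
    induction i using WellFoundedLT.induction with
    | ind i ih =>
      rw [hs]
      refine iSup_lt_ord hθ (by simpa using mk_Iio_lt i (by simp)) fun j => ?_
      exact (isSuccLimit_ord hθ.aleph0_le).add_one_lt (ht _ (ih j j.2)).1
  have hst : ∀ i j, j < i → t (s j) < s i := fun i j hij => by
    rw [hs i, ← add_one_le_iff]
    exact Ordinal.le_iSup (fun j : Iio i => t (s j) + 1) ⟨j, hij⟩
  refine ⟨fun x => {i | s i < a x ∧ cs x (pos x (s i)) ≤ t (s i)}, fun x => ?_, fun i =>
    (h.tail _ (hslt i)).and (ht _ (hslt i)).2⟩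
  rw [← mk_ord_toType (a x).cof]
  refine mk_le_of_injective (f := fun i : {i | s i < a x ∧ cs x (pos x (s i)) ≤ t (s i)} =>
    (ToType.mk ⟨pos x (s i.1), (hpos x _ i.2.1).1⟩ : (a x).cof.ord.ToType)) fun i j hij => ?_
  have hp : pos x (s i.1) = pos x (s j.1) := congrArg Subtype.val (ToType.mk.injective hij)
  have key : ∀ i j : {i | s i < a x ∧ cs x (pos x (s i)) ≤ t (s i)},
      pos x (s i.1) = pos x (s j.1) → ¬ i.1 < j.1 := fun i j hp hlt => by
    have h1 := (hpos x _ j.2.1).2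
    rw [← hp] at h1
    exact ((i.2.2.trans_lt (hst _ _ hlt)).trans_le h1).false
  exact Subtype.ext (le_antisymm (not_lt.1 (key j i hp.symm)) (not_lt.1 (key i j hp)))

/-! ### The successor of a singular cardinal -/

theorem isRegular_cof_of_lt {γ : Cardinal.{u}} (hγ : ℵ₀ ≤ γ) {o : Ordinal.{u}} (h : γ < o.cof) :
    o.cof.IsRegular :=
  isRegular_cof (one_lt_cof_iff.1 (aleph0_le_cof_iff.1 (hγ.trans h.le)))

/-- The gap lets positions in `a x` be bounded by functions of the cofinality of `a x` alone. One
function η dominates all λ⁺ of these bounds modulo `U`, so the η-th term of the cofinal sequence is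
regressive yet unbounded. -/
theorem not_isFrechet_succ {lam γ : Cardinal.{u}} (hlam : lam.IsSingular) (hγ : ℵ₀ ≤ γ)
    (hγlam : γ < lam) (hcof : lam.ord.cof ≤ γ) (hgap : ∀ μ, γ < μ → μ ≤ lam → ¬ IsFrechet μ) :
    ¬ IsFrechet (succ lam) := by
  intro hF
  obtain ⟨X, U, a, h⟩ := exists_isNormalAlong hF
  have hU := h.countable
  have hreg := isRegular_succ hlam.aleph0_le
  have hcard : ∀ x, (a x).card ≤ lam := fun x => lt_succ_iff.1 (lt_ord.1 (h.lt x))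
  have hrle : ∀ x, (a x).cof ≤ lam := fun x => (cof_le_card _).trans (hcard x)
  have hbig : ∀ ν < lam, ∀ᶠ x in (U : Filter X), ν < (a x).cof := fun ν hν => by
    by_contra hnot
    have hle : ∀ᶠ x in (U : Filter X), (a x).cof ≤ ν := by
      simpa using Ultrafilter.eventually_not.2 hnot
    have hδlam : succ (max ν γ) < lam := hlam.isSuccLimit.succ_lt (max_lt hν hγlam)
    obtain ⟨D, hDcard, hD⟩ := h.exists_cover hreg
    refine hgap _ ((le_max_right ν γ).trans_lt (lt_succ _)) hδlam.le
      (isFrechet_of_cover hU (isRegular_succ (hγ.trans (le_max_right _ _))) ?_ D hD ?_)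
    · rw [mk_ord_toType]
      exact hδlam.le.trans (le_succ lam)
    · filter_upwards [hle] with x hx
      exact lt_succ_iff.2 ((hDcard x).trans (hx.trans (le_max_left _ _)))
  have hrreg : ∀ᶠ x in (U : Filter X), (a x).cof.IsRegular ∧ γ < (a x).cof :=
    (hbig γ hγlam).mono fun x hx => ⟨isRegular_cof_of_lt hγ hx, hx⟩
  choose cs pos hcs hmono hpos using fun x => exists_cofinal_seq (a x)
  have hg : ∀ ξ : (succ lam).ord.ToType, ∃ g : Cardinal.{u} → Ordinal.{u},
      (∀ ρ : Cardinal.{u}, ρ.IsRegular → γ < ρ → g ρ < ρ.ord) ∧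
        ∀ᶠ x in (U : Filter X), pos x ξ ≤ g (a x).cof := fun ξ =>
    exists_uniform_bound hU hγ hlam.pos hgap (fun x => (a x).cof) (Eventually.of_forall hrle)
      (fun x => pos x ξ) ((h.tail ξ (toType_lt ξ)).mono fun x hx => (hpos x _ hx).1)
  choose g hglt hg using hg
  obtain ⟨c, idx, hc, -, hidx⟩ := exists_cofinal_seq lam.ord
  -- Since cf λ ≤ γ < ρ, this stays below ρ, while it tends to λ as ρ does.
  let p : Cardinal.{u} → Ordinal.{u} := fun ρ =>
    ⨆ i : lam.ord.cof.ord.ToType, if c i < ρ.ord then c i else 0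
  have hp : ∀ ρ : Cardinal.{u}, ρ.IsRegular → γ < ρ → p ρ < ρ.ord := fun ρ hρ hγρ => by
    refine iSup_lt_ord hρ (by simpa using hcof.trans_lt hγρ) fun i => ?_
    split_ifs with hi
    exacts [hi, hρ.ord_pos]
  choose F hFinj hFlt using fun x => exists_injOn_Iio (hcard x)
  -- Fewer than `(a y).cof` indices for almost every `y`, so their bounds have a supremum below it;
  -- a fixed ξ < `a x` lies in `T x y` for almost all `y`.
  let T : X → X → Set (succ lam).ord.ToType := fun x y =>
    {ξ | (ξ : Ordinal) < a x ∧ F x ξ < p (a y).cof}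
  have hT : ∀ x y, #(T x y) ≤ (p (a y).cof).card := fun x y => by
    rw [← mk_toType]
    refine mk_le_of_injective (f := fun ξ : T x y =>
      (ToType.mk ⟨F x ξ.1, ξ.2.2⟩ : (p (a y).cof).ToType)) fun ξ ζ hξζ => ?_
    have h1 : F x ξ.1 = F x ζ.1 := congrArg Subtype.val (ToType.mk.injective hξζ)
    exact Subtype.ext (toType_coe_injective (hFinj x ξ.2.1 ζ.2.1 h1))
  let e : X × X → Ordinal.{u} := fun q => ⨆ ξ : T q.1 q.2, g ξ.1 (a q.2).cof
  let E : Ultrafilter (X × X) := U.bind fun x => U.map (Prod.mk x)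
  have hE : CountableInterFilter (E : Filter (X × X)) :=
    countableInterFilter_bind hU (Eventually.of_forall fun x => countableInterFilter_map hU _)
  have he : ∀ᶠ q in (E : Filter (X × X)), e q < ((a q.2).cof).ord := by
    change ∀ᶠ x in (U : Filter X), ∀ᶠ y in (U : Filter X), e (x, y) < ((a y).cof).ord
    refine Eventually.of_forall fun x => hrreg.mono fun y hy => ?_
    refine iSup_lt_ord hy.1 ((hT x y).trans_lt (lt_ord.1 (hp _ hy.1 hy.2))) fun ξ => ?_
    exact hglt _ _ hy.1 hy.2
  -- Applied to the product ultrafilter with a cofinality depending on `y` only, this yields η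
  -- independent of `x`.
  obtain ⟨η, hη, heη⟩ := exists_uniform_bound hE hγ hlam.pos hgap (fun q => (a q.2).cof)
    (Eventually.of_forall fun q => hrle q.2) e he
  replace heη : ∀ᶠ x in (U : Filter X), ∀ᶠ y in (U : Filter X), e (x, y) ≤ η (a y).cof := heη
  have hgη : ∀ ξ, ∀ᶠ y in (U : Filter X), g ξ (a y).cof ≤ η (a y).cof := fun ξ => by
    obtain ⟨x, hx, hξx⟩ := (heη.and (h.tail ξ (toType_lt ξ))).exists
    have hF1 := (isSuccLimit_ord hlam.aleph0_le).add_one_lt (hFlt x _ hξx)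
    obtain ⟨hi, hle⟩ := hidx _ hF1
    obtain ⟨i, hi'⟩ := exists_toType hi
    rw [← hi'] at hle hi
    filter_upwards [hx, hbig _ (lt_ord.1 (hc _ hi))] with y hy hiy
    refine le_trans ?_ hy
    have hip : c i ≤ p (a y).cof := by
      refine le_trans ?_ (Ordinal.le_iSup _ i)
      rw [if_pos (lt_ord.2 hiy)]
    exact Ordinal.le_iSup (fun ξ : T x y => g ξ.1 (a y).cof)
      ⟨ξ, hξx, (add_one_le_iff.1 hle).trans_le hip⟩
  obtain ⟨ξ₀, hξ₀, hbd⟩ := h.regressive (fun y => cs y (η (a y).cof))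
    (hrreg.mono fun y hy => hcs y _ (hη _ hy.1 hy.2))
  obtain ⟨ξ, hξ⟩ := exists_toType ((isSuccLimit_ord hreg.aleph0_le).add_one_lt hξ₀)
  obtain ⟨y, h1, h2, h3, h4, h5⟩ :=
    (hbd.and ((hgη ξ).and ((hg ξ).and (hrreg.and (h.tail ξ (toType_lt ξ)))))).exists
  have h6 : cs y (pos y ξ) ≤ cs y (η (a y).cof) := by
    rcases (h3.trans h2).eq_or_lt with h7 | h7
    · rw [h7]
    · exact (hmono y _ _ h7 (hη _ h4.1 h4.2)).le
  have h8 := ((hpos y ξ h5).2.trans h6).trans h1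
  rw [hξ, add_one_le_iff] at h8
  exact h8.false

/-! ### The main results -/

theorem isFrechet_or_isSingular_of_isFrechet_succ {lam : Cardinal.{u}}
    (hF : IsFrechet (succ lam)) :
    IsFrechet lam ∨ (IsSingular lam ∧ ∃ γ < lam, ∀ δ : Cardinal.{u}, δ.IsRegular → γ ≤ δ →
      δ < lam → IsFrechet δ) := by
  have hlam : ℵ₀ ≤ lam := by
    by_contra! hlt
    exact hF.1.not_gt (isSuccLimit_aleph0.succ_lt hlt)
  obtain hr | hs := isRegular_or_isSingular hlam
  · left
    by_contra hnot
    obtain ⟨X, U, a, h⟩ := exists_isNormalAlong hF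
    obtain ⟨γ, hγ, hall⟩ := exists_forall_isRegular_isFrechet hlam h.toIsCofinalAlong fun f hf =>
      exists_bound_of_not_isFrechet h.countable hr hnot f hf
    exact hnot (hall lam hr hγ le_rfl)
  by_cases hc : IsFrechet lam.ord.cof
  · refine or_iff_not_imp_left.2 fun hnot => absurd ?_ hnot
    refine isFrechet_of_isFrechet_cof hlam hc fun γ hγ => ?_
    by_contra! hgap
    refine not_isFrechet_succ (γ := max γ lam.ord.cof) hs (hc.1.trans (le_max_right _ _))
      (max_lt hγ hs.cof_ord_lt) (le_max_right _ _) (fun μ hμ hμlam hμF => ?_) hF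
    rcases hμlam.eq_or_lt with rfl | hlt
    · exact hnot hμF
    · exact hgap μ ((le_max_left _ _).trans_lt hμ) hlt hμF
  · right
    obtain ⟨X, U, a, h⟩ := exists_isNormalAlong hF
    obtain ⟨γ, hγ, hall⟩ := exists_forall_isRegular_isFrechet hlam h.toIsCofinalAlong fun f hf =>
      exists_bound_of_not_isFrechet_cof h.countable hlam hc f hf
    exact ⟨⟨hlam, hs.not_isRegular⟩, succ γ, hs.isSuccLimit.succ_lt hγ, fun δ hδ hγδ hδlam =>
      hall δ hδ (succ_le_iff.1 hγδ) hδlam.le⟩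

theorem IsFrechetSucc.eq_succ_or_isSuccLimit {γ : Ordinal.{u}} {lam : Cardinal.{u}}
    (h : IsFrechetSucc γ lam) : lam = succ γ.card ∨ IsSuccLimit lam := by
  obtain ⟨⟨hF, hγ⟩, hmin⟩ := h
  refine or_iff_not_imp_right.2 fun hlim => ?_
  obtain ⟨μ, rfl⟩ : ∃ μ, succ μ = lam := by
    by_contra! hne
    refine hlim (Cardinal.isSuccLimit_iff.2 ⟨(aleph0_pos.trans_le hF.1).ne', ?_⟩)
    exact isSuccPrelimit_iff_succ_ne.2 hne
  have hle : γ.card ≤ μ := lt_succ_iff.1 (lt_ord.1 hγ)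
  rcases hle.eq_or_lt with rfl | hlt
  · rfl
  exfalso
  rcases isFrechet_or_isSingular_of_isFrechet_succ hF with hμ | ⟨hs, ν, hν, hall⟩
  · exact (hmin ⟨hμ, lt_ord.2 hlt⟩).not_gt (lt_succ μ)
  · have hs' := IsSingular.of_not_isRegular hs.1 hs.2
    have h0 : ℵ₀ < μ := lt_of_le_of_ne hs.1 fun h => hs.2 (h ▸ isRegular_aleph0)
    have hδ : succ (max ν (max γ.card ℵ₀)) < μ :=
      hs'.isSuccLimit.succ_lt (max_lt hν (max_lt hlt h0))
    have hδF := hall _ (isRegular_succ ((le_max_right _ _).trans (le_max_right _ _)))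
      ((le_max_left _ _).trans (le_succ _)) hδ
    refine (hmin ⟨hδF, lt_ord.2 ?_⟩).not_gt (hδ.trans (lt_succ μ))
    exact lt_succ_iff.2 ((le_max_left _ _).trans (le_max_right _ _))

theorem IsOmegaOneStronglyCompact.isFrechet {κ δ : Cardinal.{u}}
    (hκ : IsOmegaOneStronglyCompact κ) (hδ : δ.IsRegular) (hκδ : κ ≤ δ) : IsFrechet δ := by
  have hne : (cocardinal δ.ord.ToType hδ).NeBot := by
    refine ⟨fun h => ?_⟩
    have h1 : (∅ : Set δ.ord.ToType) ∈ cocardinal δ.ord.ToType hδ := by rw [h]; exact mem_bot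
    rw [mem_cocardinal, compl_empty, mk_univ, mk_ord_toType] at h1
    exact h1.false
  obtain ⟨U, hUle, hU⟩ := hκ.2 _ (cocardinal δ.ord.ToType hδ) hne
    (CardinalInterFilter.of_cardinalInterFilter_of_le _ hκδ)
  refine ⟨hδ.aleph0_le, U, hU, fun A hA => le_antisymm (mk_set_le A) ?_⟩
  by_contra! hlt
  rw [mk_ord_toType] at hlt
  exact Ultrafilter.compl_notMem_iff.2 hA (hUle (compl_mem_cocardinal_of_card_lt hlt))

/-- If all regular cardinals from `γ` on are Fréchet, then `γ` is `ω₁`-strongly compact. -/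
theorem isOmegaOneStronglyCompact_of_forall_isFrechet {γ : Cardinal.{u}} (hγ : ℵ₀ < γ)
    (hall : ∀ δ : Cardinal.{u}, δ.IsRegular → γ ≤ δ → IsFrechet δ) :
    IsOmegaOneStronglyCompact γ := by
  refine ⟨hγ, fun I F hne hF => ?_⟩
  -- Large enough to index the members of `F`; sets covering θ then select fewer than γ members of
  -- `F` at almost every point.
  let θ : Cardinal.{u} := succ (max γ #F.sets)
  have hθ : θ.IsRegular := isRegular_succ (hγ.le.trans (le_max_left _ _))
  obtain ⟨X, U, a, h⟩ := exists_isNormalAlong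
    (hall θ hθ ((le_max_left _ _).trans (le_succ _)))
  obtain ⟨D, hDcard, hD⟩ := h.exists_cover hθ
  obtain ⟨s⟩ : Nonempty (F.sets ↪ θ.ord.ToType) := by
    rw [← Cardinal.le_def, mk_ord_toType]
    exact (le_max_right _ _).trans (le_succ _)
  have hsmall : ∀ᶠ x in (U : Filter X), #(D x) < γ := by
    filter_upwards [h.not_isFrechet_cof] with x hx
    refine (hDcard x).trans_lt ?_
    by_contra! hle
    exact hx (hall _ (isRegular_cof_of_lt le_rfl (hγ.trans_le hle)) hle)
  have hpt : ∀ x, ∃ y : I, #(D x) < γ → ∀ A : F.sets, s A ∈ D x → y ∈ A.1 := fun x => by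
    by_cases hx : #(D x) < γ
    · have hmem : (⋂ A : s ⁻¹' D x, A.1.1) ∈ F :=
        (cardinal_iInter_mem ((mk_preimage_of_injective _ _ s.injective).trans_lt hx)).2
          fun A => A.1.2
      obtain ⟨y, hy⟩ := hne.nonempty_of_mem hmem
      exact ⟨y, fun _ A hA => mem_iInter.1 hy ⟨A, hA⟩⟩
    · obtain ⟨y⟩ := hne.nonempty
      exact ⟨y, fun h => absurd h hx⟩
  choose y hy using hpt
  refine ⟨U.map y, fun A hA => ?_, countableInterFilter_map h.countable y⟩
  refine Ultrafilter.mem_map.2 ?_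
  filter_upwards [hsmall, hD (s ⟨A, hA⟩)] with x hx hxD
  exact hy x hx ⟨A, hA⟩ hxD

theorem isFrechet_of_isLeast_isOmegaOneStronglyCompact {κ : Cardinal.{u}}
    (hκ : IsLeast {μ : Cardinal.{u} | IsOmegaOneStronglyCompact μ} κ) : IsFrechet κ := by
  obtain ⟨hc, hmin⟩ := hκ
  have hc' : IsOmegaOneStronglyCompact κ := hc
  obtain hr | hs := isRegular_or_isSingular hc'.1.le
  · exact hc'.isFrechet hr le_rfl
  rcases isFrechet_or_isSingular_of_isFrechet_succ
    (hc'.isFrechet (isRegular_succ hc'.1.le) (le_succ κ)) with h | ⟨-, γ, hγ, hall⟩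
  · exact h
  have hlt : succ (max γ ℵ₀) < κ := hs.isSuccLimit.succ_lt (max_lt hγ hc'.1)
  refine absurd (hmin (isOmegaOneStronglyCompact_of_forall_isFrechet
    ((le_max_right γ ℵ₀).trans_lt (lt_succ _)) fun δ hδ hle => ?_)) hlt.not_ge
  rcases lt_or_ge δ κ with h | h
  · exact hall δ hδ (((le_max_left _ _).trans (le_succ _)).trans hle) h
  · exact hc'.isFrechet hδ h

end FrechetCardinals

theorem mainTheorem11 :
    -- the cardinal below a Fréchet successor cardinal
    (∀ lam : Cardinal.{u}, FrechetCardinals.IsFrechet (Order.succ lam) →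
      FrechetCardinals.IsFrechet lam ∨
        (FrechetCardinals.IsSingular lam ∧
          ∃ γ < lam, ∀ δ : Cardinal.{u}, δ.IsRegular → γ ≤ δ → δ < lam →
            FrechetCardinals.IsFrechet δ)) ∧
    -- the least Fréchet cardinal above an ordinal
    (∀ (γ : Ordinal.{u}) (lam : Cardinal.{u}), FrechetCardinals.IsFrechetSucc γ lam →
      lam = Order.succ γ.card ∨ Order.IsSuccLimit lam) ∧
    -- the least `ω₁`-strongly compact cardinal
    (∀ κ : Cardinal.{u},
      IsLeast {μ : Cardinal.{u} | FrechetCardinals.IsOmegaOneStronglyCompact μ} κ →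
        FrechetCardinals.IsFrechet κ) :=
  ⟨fun _ => FrechetCardinals.isFrechet_or_isSingular_of_isFrechet_succ,
    fun _ _ => FrechetCardinals.IsFrechetSucc.eq_succ_or_isSuccLimit,
    fun _ => FrechetCardinals.isFrechet_of_isLeast_isOmegaOneStronglyCompact⟩
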